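/- **Setting.** Fix finite sets of unary core predicates $\mathcal C^1$, binary core predicates $\mathcal C^2$ and unary instrumentation predicates $\mathcal I$, and one further unary core predicate $sm$ ("summarised"). A (3-valued) logical structure $S=\langle U,\iota\rangle$ interprets each predicate by a function with values in $\{0,\tfrac12,1\}$, where $\iota(sm)$ takes only the values $0,\tfrac12$; it is 2-valued if $\tfrac12$ does not occur. Put $a\sqsubseteq b$ iff $a=b$ or $b=\tfrac12$. $S\sqsubseteq S'$ means that there is a surjection $f:U\to U'$ with $\iota(p)(\vec u)\sqsubseteq\iota'(p)(f(\vec u))$ for all predicates $p$ and all $\vec u$, and $(|f^{-1}(u')|>1)\sqsubseteq\iota'(sm)(u')$ for all $u'\in U'$. First-order formulae (without transitive closure) are evaluated in Kleene logic; $x=y$ has value $0$ for different individuals and value $\neg sm(x)$ if $x$ and $y$ are the same individual. Each $q\in\mathcal I$ has a meaning formula $\alpha_q(v)$ over the core predicates. A graph $G=(N,E)$ with $E\subseteq N\times(\mathcal C^1\cup\mathcal C^2)\times N$ is identified with the 2-valued structure on $N$ in which $p\in\mathcal C^2$ holds at $(u,u')$ iff $(u,p,u')\in E$, $p\in\mathcal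 C^1$ holds at $u$ iff $(u,p,u)\in E$, $sm$ is $0$, and $q\in\mathcal I$ has at $u$ the value of $\alpha_q(u)$. A rule $P=\langle L,R\rangle$ is a pair of finite graphs with nodes from a common set of names; $N^\pm,E^\pm$ are the created ($+$: in $R$, not in $L$) and deleted ($-$: in $L$, not in $R$) nodes and edges. For an injective morphism $m:L\to G$ (a matching) and $\widehat m=m\cup\mathrm{id}_{N^+}$, the application of $P$ to $G$ is the graph $H$ with $N_H=(N_G\setminus m(N^-))\mathbin{\dot\cup}N^+$ and $E_H$ the set of those edges in $(E_G\setminus m(E^-))\cup\widehat m(E^+)$ that have both ends in $N_H$. A graph transformation system $GT=(G_0,(P_i)_{i\in J})$ has the set $reach(GT)$ of graphs obtained from $G_0$ by finitely many such applications. A shape production rule $(P,\gamma)$ adds to $P$ an update formula $\gamma(q,v)$ with free variables in $N_L$ for all $q\in\mathcal I$, $v\in N_R$. A compatibility constraint is $\varphi_1\triangleright\varphi_2$ with $\varphi_1$ a formula and $\varphi_2$ either the constant false, or a possibly negated core (not $sm$), instrumentation or equality atom whose variables are distinct; a structure satisfies it if every assignment that gives $\varphi_1$ the value $1$ gives $\varphi_2$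 the value $1$. Let $K$ be a set of constraints. Coercing $S$ gives the $\sqsubseteq$-greatest structure among those on the same universe that are embedded in $S$ by the identity and satisfy $K$; if there is none, $S$ is discarded. The production formula $\varphi_P$, with variables $N_L$, is the conjunction of the binary edges $l(n,n')$ of $L$, its unary loops $l(n)$, $\neg(n=n')$ for $n\ne n'$ in $N_L$, and $\neg sm(n)$ for $n\in N_L$. The materialisation of $S$ with respect to $P$ consists of $S$ itself if $\varphi_P$ has value $1$ under some assignment, and of all $mat_m^Y(S)$, where $\varphi_P$ has value $\tfrac12$ under $m$ and $Y\subseteq m(N_L)\cap\{u\mid\iota(sm)(u)=\tfrac12\}$: its universe is $(U\setminus(m(N_L)\setminus Y))\mathbin{\dot\cup}N_L$; edges and loops of $L$ get value $1$ on $N_L$, $sm$ gets value $0$ on $N_L$, and all other values are those of $S$ at the images under $m\cup\mathrm{id}_U$. The application of $(P,\gamma)$ to $S$, with respect to an injective $m:N_L\to U$ under which all binary edges and all unary loops of $L$ have value $1$ in $S$, is the structure on $(U\setminus m(N^-))\mathbin{\dot\cup}N^+$ in which core predicates get value $0$ on $m(E^-)$ and $1$ on $\widehat m(E^+)$, are otherwise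 unchanged between old nodes and $0$ where a created node is involved; $sm$ is $0$ on created nodes and unchanged elsewhere; $q\in\mathcal I$ has at $\widehat m(v)$, $v\in N_R$, the value of $\gamma(q,v)$ in $S$ under $m$, and is unchanged elsewhere. A step $S\to S'$ materialises $S$ with respect to a rule, coerces, applies the same rule, and coerces again. For a shape transformation system $ST=(S_0,(P_i,\gamma_i)_{i\in J})$ let $X=\{S\mid S_0\to^*S\}$ and $reach(ST)=X\setminus\{S\mid\exists S'\in X:\ S\sqsubseteq S',\ S'\not\sqsubseteq S\}$. **Theorem.** Let $GT=(G_0,(P_i)_{i\in J})$ be a graph transformation system and $ST=(S_0,(P_i,\gamma_i)_{i\in J})$ an associated shape transformation system (same rules $P_i$), with $S_0$ finite and $G_0\sqsubseteq S_0$. Assume: 1. every $G\in reach(GT)$ satisfies all compatibility constraints in $K$; 2. the update formulae are correct on reachable graphs: whenever $G\in reach(GT)$ and $H$ is the application of $P_i$ to $G$ with matching $m$, then for every $q\in\mathcal I$ the value of $q$ in $H$ at $\widehat m(v)$ is the value of $\gamma_i(q,v)$ in $G$ under $m$, for each $v\in N_{R_i}$, and the value of $q$ at each node of $N_G\setminus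 m(N_{L_i})$ is the same in $H$ as in $G$. Then $$reach(GT)\subseteq\{G\mid G\text{ is 2-valued and } G\sqsubseteq S\text{ for some }S\in reach(ST)\}.$$ -/

import Mathlib

universe u v w

namespace ShapeAnalysis

/-! ### Kleene's three truth values -/

/-- The truth values false, maybe, true of Kleene logic. -/
inductive Kleene : Type
  | zero
  | half
  | one

namespace Kleene

/-- Information order: `a` is at least as precise as `b`. -/
def Info (a b : Kleene) : Prop := a = b ∨ b = half

def neg : Kleene → Kleene
  | zero => one
  | half => half
  | one => zero

/-- Minimum in the logical order `zero < half < one`. -/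
def and : Kleene → Kleene → Kleene
  | zero, _ => zero
  | _, zero => zero
  | one, one => one
  | _, _ => half

/-- Maximum in the logical order `zero < half < one`. -/
def or : Kleene → Kleene → Kleene
  | one, _ => one
  | _, one => one
  | zero, zero => zero
  | _, _ => half

open Classical in
/-- The definite truth value of a proposition. -/
noncomputable def ofProp (p : Prop) : Kleene := if p then one else zero

open Classical in
/-- Supremum of a family in the logical order. -/
noncomputable def sup {X : Type u} (f : X → Kleene) : Kleene :=
  if ∃ x, f x = one then one else if ∃ x, f x = half then half else zero

open Classical in
/-- Infimum of a family in the logical order. -/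
noncomputable def inf {X : Type u} (f : X → Kleene) : Kleene :=
  if ∃ x, f x = zero then zero else if ∃ x, f x = half then half else one

end Kleene

/-! ### Logical structures and embeddings

The predicate symbols are: unary core predicates `C₁` (other than `sm`), binary core predicates
`C₂`, the unary core predicate `sm`, and unary instrumentation predicates `I`. -/

/-- A three-valued interpretation of the predicate symbols over the universe `U`.
The predicate `sm` takes only the values `zero` and `half`. -/
structure Interp (C₁ C₂ I : Type v) (U : Type u) where
  un : C₁ → U → Kleene
  bin : C₂ → U → U → Kleene
  ins : I → U → Kleene
  sm : U → Kleene
  sm_ne_one : ∀ x, sm x ≠ Kleene.one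

/-- A three-valued logical structure. -/
structure LStruct (C₁ C₂ I : Type v) where
  U : Type u
  interp : Interp C₁ C₂ I U

section Structures

variable {C₁ C₂ I : Type v}

/-- No predicate takes the value `half`. -/
def LStruct.TwoValued (S : LStruct.{u, v} C₁ C₂ I) : Prop :=
  (∀ p x, S.interp.un p x ≠ .half) ∧ (∀ p x y, S.interp.bin p x y ≠ .half) ∧
    (∀ q x, S.interp.ins q x ≠ .half) ∧ (∀ x, S.interp.sm x ≠ .half)

/-- The function `f` embeds `S` in `T`. -/
structure IsEmbedding (S T : LStruct.{u, v} C₁ C₂ I) (f : S.U → T.U) : Prop where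
  surj : Function.Surjective f
  un : ∀ p x, Kleene.Info (S.interp.un p x) (T.interp.un p (f x))
  bin : ∀ p x y, Kleene.Info (S.interp.bin p x y) (T.interp.bin p (f x) (f y))
  ins : ∀ q x, Kleene.Info (S.interp.ins q x) (T.interp.ins q (f x))
  sm : ∀ x, Kleene.Info (S.interp.sm x) (T.interp.sm (f x))
  card : ∀ y, Kleene.Info (Kleene.ofProp (1 < Set.encard {x | f x = y})) (T.interp.sm y)

/-- `S ⊑ T`: some function embeds `S` in `T`. -/
def LStruct.Embeds (S T : LStruct.{u, v} C₁ C₂ I) : Prop := ∃ f, IsEmbedding S T f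

/-- The maximal elements of a set of structures for the embedding preorder. -/
def maxStructs (X : Set (LStruct.{u, v} C₁ C₂ I)) : Set (LStruct.{u, v} C₁ C₂ I) :=
  X \ {S | ∃ T ∈ X, S.Embeds T ∧ ¬ T.Embeds S}

end Structures

/-! ### First-order formulae and their Kleene semantics -/

/-- First-order formulae with free variables in `α` and `n` further variables that are meant to be
bound by enclosing quantifiers. There is no transitive closure operator. -/
inductive Formula (C₁ C₂ I : Type v) (α : Type u) : ℕ → Type (max u v)
  | ff {n : ℕ} : Formula C₁ C₂ I α n
  | tt {n : ℕ} : Formula C₁ C₂ I α n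
  | un {n : ℕ} (p : C₁) (x : α ⊕ Fin n) : Formula C₁ C₂ I α n
  | bin {n : ℕ} (p : C₂) (x y : α ⊕ Fin n) : Formula C₁ C₂ I α n
  | ins {n : ℕ} (q : I) (x : α ⊕ Fin n) : Formula C₁ C₂ I α n
  | sm {n : ℕ} (x : α ⊕ Fin n) : Formula C₁ C₂ I α n
  | eq {n : ℕ} (x y : α ⊕ Fin n) : Formula C₁ C₂ I α n
  | neg {n : ℕ} (φ : Formula C₁ C₂ I α n) : Formula C₁ C₂ I α n
  | and {n : ℕ} (φ ψ : Formula C₁ C₂ I α n) : Formula C₁ C₂ I α n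
  | or {n : ℕ} (φ ψ : Formula C₁ C₂ I α n) : Formula C₁ C₂ I α n
  | ex {n : ℕ} (φ : Formula C₁ C₂ I α (n + 1)) : Formula C₁ C₂ I α n
  | all {n : ℕ} (φ : Formula C₁ C₂ I α (n + 1)) : Formula C₁ C₂ I α n

section Semantics

variable {C₁ C₂ I : Type v}

open Classical in
/-- Equality is definitely true only for one and the same individual that is not summarised. -/
noncomputable def Interp.eqVal {U : Type u} (ι : Interp C₁ C₂ I U) (x y : U) : Kleene :=
  if x = y then (ι.sm x).neg else .zero

/-- Value of a formula under the assignment `a` of the free variables and `b` of the bound ones. -/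
noncomputable def Formula.evalAux {U : Type u} {α : Type w} (ι : Interp C₁ C₂ I U) (a : α → U) :
    {n : ℕ} → Formula C₁ C₂ I α n → (Fin n → U) → Kleene
  | _, .ff, _ => .zero
  | _, .tt, _ => .one
  | _, .un p x, b => ι.un p (Sum.elim a b x)
  | _, .bin p x y, b => ι.bin p (Sum.elim a b x) (Sum.elim a b y)
  | _, .ins q x, b => ι.ins q (Sum.elim a b x)
  | _, .sm x, b => ι.sm (Sum.elim a b x)
  | _, .eq x y, b => ι.eqVal (Sum.elim a b x) (Sum.elim a b y)
  | _, .neg φ, b => (φ.evalAux ι a b).neg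
  | _, .and φ ψ, b => (φ.evalAux ι a b).and (ψ.evalAux ι a b)
  | _, .or φ ψ, b => (φ.evalAux ι a b).or (ψ.evalAux ι a b)
  | n, .ex φ, b => Kleene.sup fun x : U => φ.evalAux ι a (Fin.snoc (α := fun _ : Fin (n + 1) => U) b x)
  | n, .all φ, b => Kleene.inf fun x : U => φ.evalAux ι a (Fin.snoc (α := fun _ : Fin (n + 1) => U) b x)

/-- Value of a formula, all of whose free variables are in `α`, under an assignment. -/
noncomputable def Formula.eval {U : Type u} {α : Type w} (ι : Interp C₁ C₂ I U)
    (φ : Formula C₁ C₂ I α 0) (a : α → U) : Kleene :=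
  φ.evalAux ι a Fin.elim0

/-- Conjunction of a finite family of formulae. -/
noncomputable def Formula.bigAnd {α : Type u} {n : ℕ} (X : Type w) [Finite X]
    (φ : X → Formula C₁ C₂ I α n) : Formula C₁ C₂ I α n :=
  letI := Fintype.ofFinite X
  (((Finset.univ : Finset X).toList).map φ).foldr Formula.and Formula.tt

end Semantics

/-! ### Compatibility constraints and coercion -/

/-- A literal over distinct variables, or the constant false. The flag `b` is `true` for an atomic
formula and `false` for a negated one. -/
inductive Lit (C₁ C₂ I : Type v) (α : Type u) : Type (max u v)
  | ff
  | un (b : Bool) (p : C₁) (x : α)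
  | bin (b : Bool) (p : C₂) (x y : α) (h : x ≠ y)
  | ins (b : Bool) (q : I) (x : α)
  | eq (b : Bool) (x y : α) (h : x ≠ y)

section Coercion

variable {C₁ C₂ I : Type v}

/-- `φ` or its negation. -/
def Formula.signed {α : Type u} {n : ℕ} (b : Bool) (φ : Formula C₁ C₂ I α n) :
    Formula C₁ C₂ I α n :=
  if b then φ else φ.neg

def Lit.toFormula {α : Type u} : Lit C₁ C₂ I α → Formula C₁ C₂ I α 0
  | .ff => .ff
  | .un b p x => .signed b (.un p (.inl x))
  | .bin b p x y _ => .signed b (.bin p (.inl x) (.inl y))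
  | .ins b q x => .signed b (.ins q (.inl x))
  | .eq b x y _ => .signed b (.eq (.inl x) (.inl y))

variable (C₁ C₂ I) in
/-- A compatibility constraint: an arbitrary premise and a literal as conclusion, in `k` free
variables. -/
structure Constraint where
  k : ℕ
  premise : Formula C₁ C₂ I (Fin k) 0
  conclusion : Lit C₁ C₂ I (Fin k)

/-- Whenever the premise is definitely true, so is the conclusion. -/
def Interp.Satisfies {U : Type u} (ι : Interp C₁ C₂ I U) (c : Constraint C₁ C₂ I) : Prop :=
  ∀ z : Fin c.k → U, c.premise.eval ι z = .one → c.conclusion.toFormula.eval ι z = .one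

/-- `κ` sharpens `ι`: the identity embeds the structure of `κ` in the structure of `ι`. -/
def Interp.Sharpens {U : Type u} (κ ι : Interp C₁ C₂ I U) : Prop :=
  IsEmbedding (LStruct.mk U κ) (LStruct.mk U ι) id

/-- `T` is the result of coercing `S`: the greatest structure, in the information order, that has
the universe of `S`, sharpens `S` and satisfies all constraints. If there is no such structure
then the coercion of `S` fails, that is, `S` is discarded. -/
def Coerces (K : Set (Constraint C₁ C₂ I)) (S T : LStruct.{u, v} C₁ C₂ I) : Prop :=
  ∃ κ : Interp C₁ C₂ I S.U, T = LStruct.mk S.U κ ∧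
    κ.Sharpens S.interp ∧ (∀ c ∈ K, κ.Satisfies c) ∧
    ∀ κ' : Interp C₁ C₂ I S.U, κ'.Sharpens S.interp → (∀ c ∈ K, κ'.Satisfies c) → κ'.Sharpens κ

end Coercion

/-! ### Graphs, rules and graph transformation -/

/-- A graph with edge labels in `Λ`. -/
structure Graph (Λ : Type v) where
  N : Type u
  E : Set (N × Λ × N)

/-- Graph morphisms. -/
def Graph.IsMorphism {Λ : Type v} (G H : Graph.{u, v} Λ) (f : G.N → H.N) : Prop :=
  ∀ x l y, (x, l, y) ∈ G.E → (f x, l, f y) ∈ H.E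

/-- A graph production rule: two finite graphs, whose nodes are taken from a common type `V` of
node names. -/
structure Rule (Λ : Type v) where
  V : Type u
  NL : Finset V
  NR : Finset V
  EL : Set (V × Λ × V)
  ER : Set (V × Λ × V)
  EL_mem : ∀ x l y, (x, l, y) ∈ EL → x ∈ NL ∧ y ∈ NL
  ER_mem : ∀ x l y, (x, l, y) ∈ ER → x ∈ NR ∧ y ∈ NR

namespace Rule

variable {Λ : Type v} (P : Rule.{u, v} Λ)

/-- The left hand side as a graph. -/
def lhs : Graph.{u, v} Λ where
  N := P.NL
  E := {e | (e.1.1, e.2.1, e.2.2.1) ∈ P.EL}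

/-- Names of created nodes. -/
abbrev NPlus : Type u := {n : P.V // n ∈ P.NR ∧ n ∉ P.NL}

/-- All node names of the rule. -/
abbrev Names : Type u := {n : P.V // n ∈ P.NL ∨ n ∈ P.NR}

open Classical in
/-- The map `m ∪ id` from the node names of the rule to the disjoint union of the host universe
and the created nodes. -/
noncomputable def hat {U : Type u} (m : P.NL → U) (n : P.Names) : U ⊕ P.NPlus :=
  if h : n.1 ∈ P.NL then .inl (m ⟨n.1, h⟩) else .inr ⟨n.1, n.2.resolve_left h, h⟩

/-- The universe after application: the host nodes that are not images of deleted nodes, together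
with the created nodes. -/
abbrev ResultNodes {U : Type u} (m : P.NL → U) : Type u :=
  {x : U ⊕ P.NPlus // ∀ n : P.NL, n.1 ∉ P.NR → x ≠ .inl (m n)}

/-- The image in the host of the deleted edges. -/
def delEdges {U : Type u} (m : P.NL → U) : Set ((U ⊕ P.NPlus) × Λ × (U ⊕ P.NPlus)) :=
  {e | ∃ a b : P.Names, (a.1, e.2.1, b.1) ∈ P.EL \ P.ER ∧ P.hat m a = e.1 ∧ P.hat m b = e.2.2}

/-- The image in the host of the created edges. -/
def newEdges {U : Type u} (m : P.NL → U) : Set ((U ⊕ P.NPlus) × Λ × (U ⊕ P.NPlus)) :=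
  {e | ∃ a b : P.Names, (a.1, e.2.1, b.1) ∈ P.ER \ P.EL ∧ P.hat m a = e.1 ∧ P.hat m b = e.2.2}

/-- A matching in a graph: an injective morphism from the left hand side. -/
def IsMatching (G : Graph.{u, v} Λ) (m : P.NL → G.N) : Prop :=
  Function.Injective m ∧ P.lhs.IsMorphism G m

/-- Edges of the host graph, inside the disjoint union with the created nodes. -/
def hostEdges (G : Graph.{u, v} Λ) : Set ((G.N ⊕ P.NPlus) × Λ × (G.N ⊕ P.NPlus)) :=
  {e | ∃ x y, (x, e.2.1, y) ∈ G.E ∧ e.1 = .inl x ∧ e.2.2 = .inl y}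

/-- The result of applying the rule. Edges that lose an end point disappear. -/
def apply (G : Graph.{u, v} Λ) (m : P.NL → G.N) : Graph.{u, v} Λ where
  N := P.ResultNodes m
  E := {e | (e.1.1, e.2.1, e.2.2.1) ∈ (P.hostEdges G \ P.delEdges m) ∪ P.newEdges m}

end Rule

/-- A graph transformation system with rules indexed by `J`. -/
structure GTS (Λ : Type v) (J : Type w) where
  start : Graph.{u, v} Λ
  rule : J → Rule.{u, v} Λ

/-- One transformation step. -/
def GTS.Step {Λ : Type v} {J : Type w} (GT : GTS.{u, v, w} Λ J) (G H : Graph.{u, v} Λ) : Prop :=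
  ∃ i, ∃ m : (GT.rule i).NL → G.N, (GT.rule i).IsMatching G m ∧ H = (GT.rule i).apply G m

/-- The reachable graphs. -/
def GTS.reach {Λ : Type v} {J : Type w} (GT : GTS.{u, v, w} Λ J) : Set (Graph.{u, v} Λ) :=
  {G | Relation.ReflTransGen GT.Step GT.start G}

/-! ### Encoding of graphs -/

section Encoding

variable {C₁ C₂ I : Type v}

/-- The two-valued encoding of a graph with labels in `C₁ ⊕ C₂`, over the core predicates. -/
noncomputable def ls (G : Graph.{u, v} (C₁ ⊕ C₂)) : Interp C₁ C₂ PEmpty.{v + 1} G.N where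
  un p x := .ofProp ((x, .inl p, x) ∈ G.E)
  bin p x y := .ofProp ((x, .inr p, y) ∈ G.E)
  ins q _ := q.elim
  sm _ := .zero
  sm_ne_one _ := by simp

variable (C₁ C₂ I) in
/-- Meaning formulae: for each instrumentation predicate a formula over the core predicates with
one free variable. -/
abbrev Meaning : Type v := I → Formula C₁ C₂ PEmpty.{v + 1} Unit 0

/-- The encoding of a graph over all predicates, the instrumentation predicates being given by
their meaning formulae. -/
noncomputable def encode (M : Meaning C₁ C₂ I) (G : Graph.{u, v} (C₁ ⊕ C₂)) :
    LStruct.{u, v} C₁ C₂ I where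
  U := G.N
  interp :=
    { un := (ls G).un
      bin := (ls G).bin
      ins := fun q x => (M q).eval (ls G) fun _ => x
      sm := (ls G).sm
      sm_ne_one := (ls G).sm_ne_one }

end Encoding

/-! ### Shape transformation -/

/-- A shape production rule: a graph production rule with, for each instrumentation predicate and
each node of the right hand side, an update formula with free variables in the left hand side. -/
structure ShapeRule (C₁ C₂ I : Type v) extends Rule.{u, v} (C₁ ⊕ C₂) where
  upd : I → toRule.NR → Formula C₁ C₂ I toRule.NL 0

section Shapes

variable {C₁ C₂ I : Type v}

/-- The production formula: edges, loops, injectivity, non-summarisation. -/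
noncomputable def Rule.formula (I : Type v) [Finite C₁] [Finite C₂]
    (P : Rule.{u, v} (C₁ ⊕ C₂)) : Formula C₁ C₂ I P.NL 0 :=
  (Formula.bigAnd {t : P.NL × C₂ × P.NL // (t.1.1, Sum.inr t.2.1, t.2.2.1) ∈ P.EL}
      fun t => .bin t.1.2.1 (.inl t.1.1) (.inl t.1.2.2)).and <|
  (Formula.bigAnd {t : P.NL × C₁ // (t.1.1, Sum.inl t.2, t.1.1) ∈ P.EL}
      fun t => .un t.1.2 (.inl t.1.1)).and <|
  (Formula.bigAnd {t : P.NL × P.NL // t.1 ≠ t.2}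
      fun t => .neg (.eq (.inl t.1.1) (.inl t.1.2))).and <|
  Formula.bigAnd P.NL fun n => .neg (.sm (.inl n))

/-- The universe of a materialisation: matched nodes outside `Y` are removed and the nodes of the
left hand side are added. -/
abbrev Rule.MatNodes {Λ : Type v} (P : Rule.{u, v} Λ) {U : Type u} (m : P.NL → U) (Y : Set U) :
    Type u :=
  {x : U ⊕ P.NL // ∀ z, x = .inl z → z ∉ Set.range m \ Y}

open Classical in
/-- The materialisation of `S` according to `m` and the set `Y` of matched summary nodes that are
kept. -/
noncomputable def Rule.mat (P : Rule.{u, v} (C₁ ⊕ C₂)) (S : LStruct.{u, v} C₁ C₂ I)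
    (m : P.NL → S.U) (Y : Set S.U) : LStruct.{u, v} C₁ C₂ I where
  U := P.MatNodes m Y
  interp :=
    { un := fun p x =>
        if ∃ n, x.1 = .inr n ∧ (n.1, Sum.inl p, n.1) ∈ P.EL then .one
        else S.interp.un p (Sum.elim id m x.1)
      bin := fun p x y =>
        if ∃ n n', x.1 = .inr n ∧ y.1 = .inr n' ∧ (n.1, Sum.inr p, n'.1) ∈ P.EL then .one
        else S.interp.bin p (Sum.elim id m x.1) (Sum.elim id m y.1)
      ins := fun q x => S.interp.ins q (Sum.elim id m x.1)
      sm := fun x => Sum.elim S.interp.sm (fun _ => .zero) x.1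
      sm_ne_one := by
        rintro ⟨x | x, hx⟩
        · exact S.interp.sm_ne_one x
        · simp }

/-- `T` belongs to the materialisation of `S` with respect to `P`. -/
def Rule.Materialises [Finite C₁] [Finite C₂] (P : Rule.{u, v} (C₁ ⊕ C₂))
    (S T : LStruct.{u, v} C₁ C₂ I) : Prop :=
  (T = S ∧ ∃ m, (P.formula I).eval S.interp m = .one) ∨
  ∃ (m : P.NL → S.U) (Y : Set S.U), (P.formula I).eval S.interp m = .half ∧
    Y ⊆ Set.range m ∩ {x | S.interp.sm x = .half} ∧ T = P.mat S m Y

/-- A matching of a rule in a shape graph. -/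
def Rule.IsShapeMatching (P : Rule.{u, v} (C₁ ⊕ C₂)) (S : LStruct.{u, v} C₁ C₂ I)
    (m : P.NL → S.U) : Prop :=
  Function.Injective m ∧
    (∀ (n : P.NL) (p : C₁), (n.1, Sum.inl p, n.1) ∈ P.EL → S.interp.un p (m n) = .one) ∧
    ∀ (n n' : P.NL) (p : C₂), (n.1, Sum.inr p, n'.1) ∈ P.EL → S.interp.bin p (m n) (m n') = .one

open Classical in
/-- The application of a shape production rule to a shape graph with respect to a matching. Created
nodes have no edges besides the created ones. -/
noncomputable def ShapeRule.applyShape (P : ShapeRule.{u, v} C₁ C₂ I) (S : LStruct.{u, v} C₁ C₂ I)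
    (m : P.NL → S.U) : LStruct.{u, v} C₁ C₂ I where
  U := P.ResultNodes m
  interp :=
    { un := fun p x =>
        if (x.1, Sum.inl p, x.1) ∈ P.delEdges m then .zero
        else if (x.1, Sum.inl p, x.1) ∈ P.newEdges m then .one
        else match x.1 with
          | .inl x => S.interp.un p x
          | .inr _ => .zero
      bin := fun p x y =>
        if (x.1, Sum.inr p, y.1) ∈ P.delEdges m then .zero
        else if (x.1, Sum.inr p, y.1) ∈ P.newEdges m then .one
        else match x.1, y.1 with
          | .inl x, .inl y => S.interp.bin p x y
          | _, _ => .zero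
      ins := fun q x =>
        if h : ∃ n : P.NR, P.hat m ⟨n.1, Or.inr n.2⟩ = x.1 then
          (P.upd q h.choose).eval S.interp m
        else match x.1 with
          | .inl x => S.interp.ins q x
          | .inr _ => .zero
      sm := fun x => Sum.elim S.interp.sm (fun _ => .zero) x.1
      sm_ne_one := by
        rintro ⟨x | x, hx⟩
        · exact S.interp.sm_ne_one x
        · simp }

/-- One step on shape graphs: materialise, coerce, apply, coerce. -/
def ShapeRule.Step [Finite C₁] [Finite C₂] (K : Set (Constraint C₁ C₂ I))
    (P : ShapeRule.{u, v} C₁ C₂ I) (S T : LStruct.{u, v} C₁ C₂ I) : Prop :=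
  ∃ S₁ S₂ : LStruct.{u, v} C₁ C₂ I, P.Materialises S S₁ ∧ Coerces K S₁ S₂ ∧
    ∃ m : P.NL → S₂.U, P.IsShapeMatching S₂ m ∧ Coerces K (P.applyShape S₂ m) T

end Shapes

/-- A shape transformation system with rules indexed by `J`. -/
structure STS (C₁ C₂ I : Type v) (J : Type w) where
  start : LStruct.{u, v} C₁ C₂ I
  rule : J → ShapeRule.{u, v} C₁ C₂ I

section Systems

variable {C₁ C₂ I : Type v} {J : Type w}

/-- The maximal reachable shape graphs, coercion being with respect to the constraints in `K`. -/
def STS.reach [Finite C₁] [Finite C₂] (K : Set (Constraint C₁ C₂ I))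
    (ST : STS.{u, v, w} C₁ C₂ I J) : Set (LStruct.{u, v} C₁ C₂ I) :=
  maxStructs {S | Relation.ReflTransGen (fun S T => ∃ i, (ST.rule i).Step K S T) ST.start S}

/-- `ST` is associated with `GT`: it has the same graph production rules. -/
def STS.IsAssociated (ST : STS.{u, v, w} C₁ C₂ I J) (GT : GTS.{u, v, w} (C₁ ⊕ C₂) J) : Prop :=
  GT.rule = fun i => (ST.rule i).toRule

/-- The update formulae of `P` are correct for the application of `P` to the graph `G` with the
matching `m`: on the nodes of the right hand side they compute the meaning of the instrumentation
predicates in the new graph, and on the nodes outside the match this meaning does not change. -/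
def ShapeRule.UpdateCorrect (M : Meaning C₁ C₂ I) (P : ShapeRule.{u, v} C₁ C₂ I)
    (G : Graph.{u, v} (C₁ ⊕ C₂)) (m : P.NL → G.N) : Prop :=
  ∀ (q : I) (x : P.ResultNodes m),
    (∀ n : P.NR, P.hat m ⟨n.1, Or.inr n.2⟩ = x.1 →
      (encode M (P.apply G m)).interp.ins q x = (P.upd q n).eval (encode M G).interp m) ∧
    (∀ z : G.N, z ∉ Set.range m → x.1 = .inl z →
      (encode M (P.apply G m)).interp.ins q x = (encode M G).interp.ins q z)

end Systems

end ShapeAnalysis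

/-!
Every reachable graph is embedded in some finite reachable shape graph; this is shown by induction
on the derivation of the graph, each graph transformation step being simulated by a step on shape
graphs. Let `f` embed the graph `G` in `S`, and let `m` be a matching in `G`.

* Materialisation. By the embedding theorem (`IsEmbedding.info_eval`), the production formula does
  not have the value `zero` under `f ∘ m`. If it has the value `one`, then `S` itself is used. If it
  has the value `half`, then `G` is embedded in the materialisation of `S` that keeps those matched
  individuals which also represent unmatched nodes (`IsEmbedding.exists_materialises`). In both
  cases the match becomes definite: its edges have the value `one`, and its individuals are not
  summarised, so that each of them represents a single node of `G`.
* Coercion. The result of coercing `S` is the pointwise least upper bound `modelJoin K S` of all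
  models of the constraints that are embedded in `S`, with whatever universe. `G` is one of them,
  and therefore it is embedded in the result. That the bound satisfies the constraints
  (`IsModelOf.modelJoin_satisfies`) rests on their form: the conclusion is a literal over distinct
  variables, which can be lifted to the models independently.
* Application. As the match is definite, applying the rule commutes with the embedding, the
  correctness of the update formulae covering the instrumentation predicates
  (`ShapeRule.exists_isEmbedding_apply`). The new graph satisfies the constraints, so the second
  coercion succeeds as well.

The shape graph obtained need not be maximal. But it is finite, hence it has only finitely many
abstractions up to mutual embedding, and a maximal reachable shape graph lies above it
(`exists_mem_maxStructs`).
-/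

namespace ShapeAnalysis

/-! ### The information order -/

namespace Kleene

theorem Info.refl (a : Kleene) : Info a a := Or.inl rfl

theorem Info.trans {a b c : Kleene} (h : Info a b) (h' : Info b c) : Info a c := by
  rcases h with rfl | rfl
  · exact h'
  · rcases h' with rfl | rfl <;> exact Or.inr rfl

theorem Info.eq_of_ne_half {a b : Kleene} (h : Info a b) (hb : b ≠ half) : a = b :=
  h.resolve_right hb

theorem info_zero_of_ne_one {b : Kleene} (hb : b ≠ one) : Info zero b := by
  cases b
  exacts [Or.inl rfl, Or.inr rfl, absurd rfl hb]

theorem Info.neg {a b : Kleene} (h : Info a b) : Info a.neg b.neg := by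
  rcases h with rfl | rfl
  · exact Or.inl rfl
  · exact Or.inr rfl

theorem Info.and {a b c d : Kleene} (h : Info a b) (h' : Info c d) :
    Info (a.and c) (b.and d) := by
  rcases h with rfl | rfl <;> rcases h' with rfl | rfl <;> cases a <;> cases c <;>
    simp [Info, Kleene.and]

theorem Info.or {a b c d : Kleene} (h : Info a b) (h' : Info c d) :
    Info (a.or c) (b.or d) := by
  rcases h with rfl | rfl <;> rcases h' with rfl | rfl <;> cases a <;> cases c <;>
    simp [Info, Kleene.or]

theorem neg_eq_one {a : Kleene} : a.neg = one ↔ a = zero := by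
  cases a <;> simp [neg]

theorem and_eq_one {a b : Kleene} : a.and b = one ↔ a = one ∧ b = one := by
  cases a <;> cases b <;> simp [and]

theorem neg_ne_half {a : Kleene} (h : a ≠ half) : a.neg ≠ half := by
  cases a <;> simp_all [neg]

theorem and_ne_half {a b : Kleene} (h : a ≠ half) (h' : b ≠ half) : a.and b ≠ half := by
  cases a <;> cases b <;> simp_all [and]

theorem or_ne_half {a b : Kleene} (h : a ≠ half) (h' : b ≠ half) : a.or b ≠ half := by
  cases a <;> cases b <;> simp_all [or]

theorem ofProp_ne_half (p : Prop) : ofProp p ≠ half := by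
  unfold ofProp; split_ifs <;> simp

theorem sup_ne_half {X : Type u} {f : X → Kleene} (h : ∀ x, f x ≠ half) : sup f ≠ half := by
  unfold sup; split_ifs <;> simp_all

theorem inf_ne_half {X : Type u} {f : X → Kleene} (h : ∀ x, f x ≠ half) : inf f ≠ half := by
  unfold inf; split_ifs <;> simp_all

theorem neg_sup_neg {X : Type u} (f : X → Kleene) : (sup fun x => (f x).neg).neg = inf f := by
  have h1 : ∀ a : Kleene, a.neg = half ↔ a = half := by intro a; cases a <;> simp [neg]
  by_cases h0 : ∃ x, f x = zero
  · simp only [sup, inf, h1, neg_eq_one, h0, if_true]; rfl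
  · by_cases h : ∃ x, f x = half <;>
      simp only [sup, inf, h1, neg_eq_one, h0, h, if_true, if_false]

theorem Info.sup {X Y : Type u} {a : X → Kleene} {b : Y → Kleene} {f : X → Y}
    (hf : Function.Surjective f) (h : ∀ x, Info (a x) (b (f x))) :
    Info (sup a) (sup b) := by
  unfold Kleene.sup
  by_cases h1 : ∃ y, b y = one
  · have h2 : ∃ x, a x = one := by
      obtain ⟨y, hy⟩ := h1
      obtain ⟨x, rfl⟩ := hf y
      exact ⟨x, by rw [(h x).eq_of_ne_half (by simp [hy]), hy]⟩
    rw [if_pos h1, if_pos h2]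
    exact Info.refl _
  · rw [if_neg h1]
    by_cases h2 : ∃ y, b y = half
    · rw [if_pos h2]
      exact Or.inr rfl
    · have h3 : ∀ x, a x = b (f x) := fun x => (h x).eq_of_ne_half fun e => h2 ⟨_, e⟩
      rw [if_neg h2, if_neg fun ⟨x, hx⟩ => h1 ⟨f x, h3 x ▸ hx⟩,
        if_neg fun ⟨x, hx⟩ => h2 ⟨f x, h3 x ▸ hx⟩]
      exact Info.refl _

theorem Info.inf {X Y : Type u} {a : X → Kleene} {b : Y → Kleene} {f : X → Y}
    (hf : Function.Surjective f) (h : ∀ x, Info (a x) (b (f x))) :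
    Info (inf a) (inf b) := by
  rw [← neg_sup_neg, ← neg_sup_neg]
  exact (Info.sup hf fun x => (h x).neg).neg

open Classical in
/-- The least upper bound, in the information order, of the truth values with property `A`. If there
are none, it does not exist, and `zero` is returned. -/
noncomputable def infoSup (A : Kleene → Prop) : Kleene :=
  if ∀ a, A a → a = zero then zero else if ∀ a, A a → a = one then one else half

theorem info_infoSup {A : Kleene → Prop} {a : Kleene} (ha : A a) : Info a (infoSup A) := by
  unfold infoSup
  split_ifs with h h'
  exacts [Or.inl (h a ha), Or.inl (h' a ha), Or.inr rfl]

theorem infoSup_info {A : Kleene → Prop} (hA : ∃ a, A a) {b : Kleene} (h : ∀ a, A a → Info a b) :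
    Info (infoSup A) b := by
  obtain ⟨a, ha⟩ := hA
  rcases eq_or_ne b half with rfl | hb
  · exact Or.inr rfl
  · have hA : ∀ a, A a → a = b := fun a ha => (h a ha).eq_of_ne_half hb
    obtain rfl := hA a ha
    left
    unfold infoSup
    cases a
    · rw [if_pos hA]
    · exact absurd rfl hb
    · rw [if_neg fun hz => by simpa using hz _ ha, if_pos hA]

theorem infoSup_eq {A : Kleene → Prop} (hA : ∃ a, A a) {b : Kleene} (hb : b ≠ half)
    (h : ∀ a, A a → a = b) : infoSup A = b :=
  (infoSup_info hA fun a ha => Or.inl (h a ha)).eq_of_ne_half hb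

end Kleene

open Kleene

variable {C₁ C₂ I : Type v}

/-! ### Embeddings -/

theorem Interp.sm_eq_zero_or_half {U : Type u} (ι : Interp C₁ C₂ I U) (x : U) :
    ι.sm x = zero ∨ ι.sm x = half := by
  have := ι.sm_ne_one x
  cases h : ι.sm x <;> simp_all

theorem IsEmbedding.sm_eq_half {S T : LStruct.{u, v} C₁ C₂ I} {f : S.U → T.U}
    (hf : IsEmbedding S T f) {x x' : S.U} (h : f x = f x') (hne : x ≠ x') :
    T.interp.sm (f x) = half := by
  have := hf.card (f x)
  have hc : 1 < Set.encard {z | f z = f x} :=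
    Set.one_lt_encard_iff.2 ⟨x, x', by simp, by simp [h], hne⟩
  rw [ofProp, if_pos hc] at this
  exact this.resolve_left (T.interp.sm_ne_one _).symm

/-- An individual that is definitely not summarised represents at most one individual. -/
theorem IsEmbedding.eq_of_sm_eq_zero {S T : LStruct.{u, v} C₁ C₂ I} {f : S.U → T.U}
    (hf : IsEmbedding S T f) {x x' : S.U} (h0 : T.interp.sm (f x) = zero) (h : f x' = f x) :
    x' = x := by
  by_contra hne
  have := hf.sm_eq_half h.symm (Ne.symm hne)
  simp [h0] at this

/-- The cardinality condition of an embedding, in terms of pairs of identified individuals. -/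
theorem info_card {S T : LStruct.{u, v} C₁ C₂ I} {f : S.U → T.U}
    (h : ∀ x x', f x = f x' → x ≠ x' → T.interp.sm (f x) = half) (y : T.U) :
    Info (ofProp (1 < Set.encard {x | f x = y})) (T.interp.sm y) := by
  unfold ofProp
  split_ifs with hc
  · obtain ⟨x, x', hx, hx', hne⟩ := Set.one_lt_encard_iff.1 hc
    rw [Set.mem_ofPred_eq] at hx hx'
    subst hx
    exact Or.inr (h x x' hx'.symm hne)
  · exact info_zero_of_ne_one (T.interp.sm_ne_one y)

theorem IsEmbedding.refl (S : LStruct.{u, v} C₁ C₂ I) : IsEmbedding S S id where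
  surj := Function.surjective_id
  un _ _ := Info.refl _
  bin _ _ _ := Info.refl _
  ins _ _ := Info.refl _
  sm _ := Info.refl _
  card := info_card fun _ _ h hne => absurd h hne

theorem IsEmbedding.trans {S T R : LStruct.{u, v} C₁ C₂ I} {f : S.U → T.U} {g : T.U → R.U}
    (hf : IsEmbedding S T f) (hg : IsEmbedding T R g) : IsEmbedding S R (g ∘ f) where
  surj := hg.surj.comp hf.surj
  un p x := (hf.un p x).trans (hg.un p _)
  bin p x y := (hf.bin p x y).trans (hg.bin p _ _)
  ins q x := (hf.ins q x).trans (hg.ins q _)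
  sm x := (hf.sm x).trans (hg.sm _)
  card := info_card fun x x' h hne => by
    -- Individuals may be merged by `f` already, which makes their image a summary individual.
    by_cases hfx : f x = f x'
    · have := hg.sm (f x)
      rw [hf.sm_eq_half hfx hne] at this
      rcases this with e | e
      exacts [e.symm, e]
    · exact hg.sm_eq_half h hfx

theorem Embeds.refl (S : LStruct.{u, v} C₁ C₂ I) : S.Embeds S := ⟨id, .refl S⟩

theorem Embeds.trans {S T R : LStruct.{u, v} C₁ C₂ I} (h : S.Embeds T) (h' : T.Embeds R) :
    S.Embeds R := by
  obtain ⟨f, hf⟩ := h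
  obtain ⟨g, hg⟩ := h'
  exact ⟨_, hf.trans hg⟩

/-! ### Evaluation of formulae -/

theorem IsEmbedding.info_evalAux {S T : LStruct.{u, v} C₁ C₂ I} {f : S.U → T.U}
    (hf : IsEmbedding S T f) {α : Type w} (a : α → S.U) {n : ℕ} (φ : Formula C₁ C₂ I α n)
    (b : Fin n → S.U) :
    Info (φ.evalAux S.interp a b) (φ.evalAux T.interp (f ∘ a) (f ∘ b)) := by
  have hv : ∀ {n : ℕ} (b : Fin n → S.U) (x : α ⊕ Fin n),
      Sum.elim (f ∘ a) (f ∘ b) x = f (Sum.elim a b x) := by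
    rintro n b (x | x) <;> rfl
  induction φ with
  | ff => exact Info.refl _
  | tt => exact Info.refl _
  | un p x => simpa only [Formula.evalAux, hv] using hf.un p _
  | bin p x y => simpa only [Formula.evalAux, hv] using hf.bin p _ _
  | ins q x => simpa only [Formula.evalAux, hv] using hf.ins q _
  | sm x => simpa only [Formula.evalAux, hv] using hf.sm _
  | eq x y =>
    simp only [Formula.evalAux, hv]
    generalize Sum.elim a b x = s
    generalize Sum.elim a b y = t
    unfold Interp.eqVal
    by_cases hst : s = t
    · subst hst
      simpa using (hf.sm s).neg
    · rw [if_neg hst]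
      split_ifs with h
      · rw [hf.sm_eq_half h hst]
        exact Or.inr rfl
      · exact Info.refl _
  | neg φ ih => exact (ih b).neg
  | and φ ψ ih ih' => exact (ih b).and (ih' b)
  | or φ ψ ih ih' => exact (ih b).or (ih' b)
  | ex φ ih =>
    refine Info.sup hf.surj fun x => ?_
    rw [← Fin.comp_snoc]
    exact ih _
  | all φ ih =>
    refine Info.inf hf.surj fun x => ?_
    rw [← Fin.comp_snoc]
    exact ih _

/-- The embedding theorem: the value of a formula in an abstraction of a structure is correct,
though possibly less precise. -/
theorem IsEmbedding.info_eval {S T : LStruct.{u, v} C₁ C₂ I} {f : S.U → T.U}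
    (hf : IsEmbedding S T f) {α : Type w} (φ : Formula C₁ C₂ I α 0) (a : α → S.U) :
    Info (φ.eval S.interp a) (φ.eval T.interp (f ∘ a)) := by
  have := hf.info_evalAux a φ Fin.elim0
  rwa [Subsingleton.elim (f ∘ Fin.elim0) Fin.elim0] at this

theorem IsEmbedding.eval_eq_one {S T : LStruct.{u, v} C₁ C₂ I} {f : S.U → T.U}
    (hf : IsEmbedding S T f) {α : Type w} {φ : Formula C₁ C₂ I α 0} {a : α → S.U}
    (h : φ.eval T.interp (f ∘ a) = one) : φ.eval S.interp a = one := by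
  rw [(hf.info_eval φ a).eq_of_ne_half (by simp [h]), h]

theorem Interp.eqVal_ne_half {U : Type u} {ι : Interp C₁ C₂ I U} (hs : ∀ x, ι.sm x ≠ half)
    (x y : U) : ι.eqVal x y ≠ half := by
  unfold Interp.eqVal
  split_ifs
  exacts [neg_ne_half (hs x), by simp]

theorem LStruct.TwoValued.evalAux_ne_half {S : LStruct.{u, v} C₁ C₂ I} (hS : S.TwoValued)
    {α : Type w} (a : α → S.U) {n : ℕ} (φ : Formula C₁ C₂ I α n) (b : Fin n → S.U) :
    φ.evalAux S.interp a b ≠ half := by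
  obtain ⟨h1, h2, h3, h4⟩ := hS
  induction φ with
  | ff => simp [Formula.evalAux]
  | tt => simp [Formula.evalAux]
  | un p x => exact h1 _ _
  | bin p x y => exact h2 _ _ _
  | ins q x => exact h3 _ _
  | sm x => exact h4 _
  | eq x y => exact Interp.eqVal_ne_half h4 _ _
  | neg φ ih => exact neg_ne_half (ih b)
  | and φ ψ ih ih' => exact and_ne_half (ih b) (ih' b)
  | or φ ψ ih ih' => exact or_ne_half (ih b) (ih' b)
  | ex φ ih => exact sup_ne_half fun x => ih _
  | all φ ih => exact inf_ne_half fun x => ih _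

theorem encode_twoValued (M : Meaning C₁ C₂ I) (G : Graph.{u, v} (C₁ ⊕ C₂)) :
    (encode M G).TwoValued := by
  have h : (LStruct.mk G.N (ls G)).TwoValued :=
    ⟨fun _ _ => ofProp_ne_half _, fun _ _ _ => ofProp_ne_half _, fun q => q.elim,
      fun _ => by simp [ls]⟩
  exact ⟨h.1, h.2.1, fun q x => h.evalAux_ne_half _ (M q) _, h.2.2.2⟩

theorem Interp.eqVal_eq_one {U : Type u} {ι : Interp C₁ C₂ I U} {x y : U} :
    ι.eqVal x y = one ↔ x = y ∧ ι.sm x = zero := by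
  unfold Interp.eqVal
  split_ifs with h <;> simp [h, neg_eq_one]

theorem Interp.eqVal_eq_zero {U : Type u} {ι : Interp C₁ C₂ I U} {x y : U} :
    ι.eqVal x y = zero ↔ x ≠ y := by
  unfold Interp.eqVal
  split_ifs with h
  · have := ι.sm_ne_one x
    cases h' : ι.sm x <;> simp_all [neg]
  · simp [h]

theorem Formula.evalAux_bigAnd {U : Type u} {α : Type w} {ι : Interp C₁ C₂ I U} {a : α → U}
    {n : ℕ} {b : Fin n → U} {X : Type*} [Finite X] {φ : X → Formula C₁ C₂ I α n} :
    (Formula.bigAnd X φ).evalAux ι a b = one ↔ ∀ x, (φ x).evalAux ι a b = one := by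
  have key : ∀ l : List (Formula C₁ C₂ I α n),
      (l.foldr Formula.and Formula.tt).evalAux ι a b = one ↔ ∀ ψ ∈ l, ψ.evalAux ι a b = one := by
    intro l
    induction l with
    | nil => simp [Formula.evalAux]
    | cons ψ l ih => simp [Formula.evalAux, and_eq_one, ih]
  simp [Formula.bigAnd, key]

/-- A definite value of the production formula means that the assignment is an injective match of
the left hand side on individuals that are not summarised. -/
theorem Rule.formula_eval_eq_one [Finite C₁] [Finite C₂] (P : Rule.{u, v} (C₁ ⊕ C₂))
    {U : Type u} {ι : Interp C₁ C₂ I U} {m : P.NL → U} :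
    (P.formula I).eval ι m = one ↔
      (∀ (n n' : P.NL) (p : C₂), (n.1, Sum.inr p, n'.1) ∈ P.EL → ι.bin p (m n) (m n') = one) ∧
      (∀ (n : P.NL) (p : C₁), (n.1, Sum.inl p, n.1) ∈ P.EL → ι.un p (m n) = one) ∧
      Function.Injective m ∧ ∀ n, ι.sm (m n) = zero := by
  simp only [Formula.eval, Rule.formula, Formula.evalAux, and_eq_one, Formula.evalAux_bigAnd,
    neg_eq_one, Interp.eqVal_eq_zero, Sum.elim_inl]
  refine and_congr ?_ (and_congr ?_ (and_congr ?_ Iff.rfl))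
  · exact ⟨fun h n n' p hp => h ⟨(n, p, n'), hp⟩, fun h t => h _ _ _ t.2⟩
  · exact ⟨fun h n p hp => h ⟨(n, p), hp⟩, fun h t => h _ _ t.2⟩
  · exact ⟨fun h n n' e => by_contra fun hne => h ⟨(n, n'), hne⟩ e, fun h t e => t.2 (h e)⟩

/-! ### Coercion -/

/-- `T` satisfies all constraints, and `f` embeds it in `S`. -/
structure IsModelOf (K : Set (Constraint C₁ C₂ I)) (T S : LStruct.{u, v} C₁ C₂ I)
    (f : T.U → S.U) : Prop where
  emb : IsEmbedding T S f
  sat : ∀ c ∈ K, T.interp.Satisfies c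

open Classical in
/-- The least abstraction, on the universe of `S`, of all models of the constraints that are
embedded in `S`. An individual is summarised if and only if it represents, for some model, several
individuals or a summarised one. -/
noncomputable def modelJoin (K : Set (Constraint C₁ C₂ I)) (S : LStruct.{u, v} C₁ C₂ I) :
    Interp C₁ C₂ I S.U where
  un p x := infoSup fun a => ∃ T f, IsModelOf K T S f ∧ ∃ w, f w = x ∧ T.interp.un p w = a
  bin p x y := infoSup fun a => ∃ T f, IsModelOf K T S f ∧
    ∃ w w', f w = x ∧ f w' = y ∧ T.interp.bin p w w' = a
  ins q x := infoSup fun a => ∃ T f, IsModelOf K T S f ∧ ∃ w, f w = x ∧ T.interp.ins q w = a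
  sm x := if ∀ T f, IsModelOf K T S f →
    ∀ w, f w = x → T.interp.sm w = zero ∧ ∀ w', f w' = x → w = w' then zero else half
  sm_ne_one x := by split_ifs <;> simp

section ModelJoin

variable {K : Set (Constraint C₁ C₂ I)} {T S : LStruct.{u, v} C₁ C₂ I} {f : T.U → S.U}

theorem IsModelOf.embeds_modelJoin (h : IsModelOf K T S f) :
    IsEmbedding T (.mk S.U (modelJoin K S)) f where
  surj := h.emb.surj
  un p x := info_infoSup ⟨T, f, h, x, rfl, rfl⟩
  bin p x y := info_infoSup ⟨T, f, h, x, y, rfl, rfl, rfl⟩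
  ins q x := info_infoSup ⟨T, f, h, x, rfl, rfl⟩
  sm x := by
    classical
    change Info _ (ite _ _ _)
    split_ifs with hz
    · exact Or.inl (hz T f h x rfl).1
    · exact Or.inr rfl
  card := info_card fun x x' hxx' hne => by
    classical
    change ite _ _ _ = _
    rw [if_neg fun hz => hne ((hz T f h x rfl).2 x' hxx'.symm)]

/-- The join lies below `S` because `S` is an upper bound of the models. Without a model the join
has no meaning, so one is assumed. -/
theorem IsModelOf.modelJoin_sharpens (h : IsModelOf K T S f) :
    (modelJoin K S).Sharpens S.interp where
  surj := Function.surjective_id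
  un p x := by
    obtain ⟨w, rfl⟩ := h.emb.surj x
    refine infoSup_info ⟨_, T, f, h, w, rfl, rfl⟩ ?_
    rintro _ ⟨T', f', h', w', e, rfl⟩
    simpa only [id, e] using h'.emb.un p w'
  bin p x y := by
    obtain ⟨w, rfl⟩ := h.emb.surj x
    obtain ⟨z, rfl⟩ := h.emb.surj y
    refine infoSup_info ⟨_, T, f, h, w, z, rfl, rfl, rfl⟩ ?_
    rintro _ ⟨T', f', h', w', z', e, e', rfl⟩
    simpa only [id, e, e'] using h'.emb.bin p w' z'
  ins q x := by
    obtain ⟨w, rfl⟩ := h.emb.surj x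
    refine infoSup_info ⟨_, T, f, h, w, rfl, rfl⟩ ?_
    rintro _ ⟨T', f', h', w', e, rfl⟩
    simpa only [id, e] using h'.emb.ins q w'
  sm x := by
    classical
    change Info (ite _ _ _) (S.interp.sm x)
    rcases S.interp.sm_eq_zero_or_half x with h0 | h0
    · rw [if_pos, h0]
      · exact Info.refl _
      · rintro T' f' h' w rfl
        refine ⟨?_, fun w' hw' => (h'.emb.eq_of_sm_eq_zero h0 hw').symm⟩
        rw [(h'.emb.sm w).eq_of_ne_half (by simp [h0]), h0]
    · exact Or.inr h0
  card := info_card fun _ _ e hne => absurd e hne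

/-- The join of models is a model. If the premise of a constraint is definitely true in the join,
then it is so in every model, for all assignments above the given one. So is the conclusion; as
its variables are distinct, their preimages can be chosen independently of each other, whence
the conclusion has the same definite value throughout, which is its value in the join. -/
theorem IsModelOf.modelJoin_satisfies (h : IsModelOf K T S f) {c : Constraint C₁ C₂ I}
    (hc : c ∈ K) : (modelJoin K S).Satisfies c := by
  classical
  intro z hz
  have key : ∀ (T' : LStruct.{u, v} C₁ C₂ I) (f' : T'.U → S.U), IsModelOf K T' S f' →
      ∀ a : Fin c.k → T'.U, f' ∘ a = z → c.conclusion.toFormula.eval T'.interp a = one := by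
    rintro T' f' h' a rfl
    exact h'.sat c hc a (h'.embeds_modelJoin.eval_eq_one hz)
  have lift : ∀ (T' : LStruct.{u, v} C₁ C₂ I) (f' : T'.U → S.U), IsModelOf K T' S f' →
      ∃ a : Fin c.k → T'.U, f' ∘ a = z := fun T' f' h' =>
    ⟨fun i => (h'.emb.surj (z i)).choose, funext fun i => (h'.emb.surj (z i)).choose_spec⟩
  have lift₁ : ∀ (T' : LStruct.{u, v} C₁ C₂ I) (f' : T'.U → S.U), IsModelOf K T' S f' →
      ∀ i w, f' w = z i → ∃ a : Fin c.k → T'.U, f' ∘ a = z ∧ a i = w := by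
    intro T' f' h' i w hw
    obtain ⟨a, rfl⟩ := lift T' f' h'
    refine ⟨Function.update a i w, ?_, by simp⟩
    rw [Function.comp_update, hw, Function.comp_apply]
    exact Function.update_eq_self i (f' ∘ a)
  have lift₂ : ∀ (T' : LStruct.{u, v} C₁ C₂ I) (f' : T'.U → S.U), IsModelOf K T' S f' →
      ∀ i j, i ≠ j → ∀ w w', f' w = z i → f' w' = z j →
        ∃ a : Fin c.k → T'.U, f' ∘ a = z ∧ a i = w ∧ a j = w' := by
    intro T' f' h' i j hij w w' hw hw'
    obtain ⟨a, rfl, rfl⟩ := lift₁ T' f' h' i w hw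
    refine ⟨Function.update a j w', ?_, by simp [hij], by simp⟩
    rw [Function.comp_update, hw', Function.comp_apply]
    exact Function.update_eq_self j (f' ∘ a)
  obtain ⟨a₀, ha₀⟩ := lift T f h
  have h₀ := key T f h a₀ ha₀
  subst ha₀
  generalize c.conclusion = l at key h₀ ⊢
  cases l with
  | ff => simp [Lit.toFormula, Formula.eval, Formula.evalAux] at h₀
  | un b p i =>
    cases b <;> simp only [Lit.toFormula, Formula.signed, Formula.eval, Formula.evalAux, if_true,
      if_false, Bool.false_eq_true, neg_eq_one, Sum.elim_inl] at key ⊢ <;>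
    · refine infoSup_eq ⟨_, T, f, h, a₀ i, rfl, rfl⟩ (by simp) ?_
      rintro _ ⟨T', f', h', w, hw, rfl⟩
      obtain ⟨a, ha, rfl⟩ := lift₁ T' f' h' i w hw
      exact key T' f' h' a ha
  | ins b q i =>
    cases b <;> simp only [Lit.toFormula, Formula.signed, Formula.eval, Formula.evalAux, if_true,
      if_false, Bool.false_eq_true, neg_eq_one, Sum.elim_inl] at key ⊢ <;>
    · refine infoSup_eq ⟨_, T, f, h, a₀ i, rfl, rfl⟩ (by simp) ?_
      rintro _ ⟨T', f', h', w, hw, rfl⟩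
      obtain ⟨a, ha, rfl⟩ := lift₁ T' f' h' i w hw
      exact key T' f' h' a ha
  | bin b p i j hij =>
    cases b <;> simp only [Lit.toFormula, Formula.signed, Formula.eval, Formula.evalAux, if_true,
      if_false, Bool.false_eq_true, neg_eq_one, Sum.elim_inl] at key ⊢ <;>
    · refine infoSup_eq ⟨_, T, f, h, a₀ i, a₀ j, rfl, rfl, rfl⟩ (by simp) ?_
      rintro _ ⟨T', f', h', w, w', hw, hw', rfl⟩
      obtain ⟨a, ha, rfl, rfl⟩ := lift₂ T' f' h' i j hij w w' hw hw'
      exact key T' f' h' a ha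
  | eq b i j hij =>
    cases b <;> simp only [Lit.toFormula, Formula.signed, Formula.eval, Formula.evalAux, if_true,
      if_false, Bool.false_eq_true, neg_eq_one, Sum.elim_inl, Interp.eqVal_eq_zero,
      Interp.eqVal_eq_one] at key h₀ ⊢
    · -- If both variables had the same value, then they would have a common preimage.
      intro e
      obtain ⟨a, ha, hi, hj⟩ := lift₂ T f h i j hij (a₀ i) (a₀ i) rfl e
      exact key T f h a ha (hi.trans hj.symm)
    · have e : f (a₀ i) = f (a₀ j) := congrArg f h₀.1
      refine ⟨e, if_pos fun T' f' h' w hw => ?_⟩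
      -- Independent choices of two preimages always agree, so that fibres are singletons.
      have hww : ∀ w', f' w' = f (a₀ i) → w = w' ∧ T'.interp.sm w = zero := by
        intro w' hw'
        obtain ⟨a, ha, rfl, rfl⟩ := lift₂ T' f' h' i j hij w w' hw (hw'.trans e)
        exact key T' f' h' a ha
      exact ⟨(hww w hw).2, fun w' hw' => (hww w' hw').1⟩

/-- As soon as some model of the constraints is embedded in `S`, coercion of `S` succeeds, and all
models that are embedded in `S` remain embedded in the result. -/
theorem IsModelOf.coerces (h : IsModelOf K T S f) :
    Coerces K S (.mk S.U (modelJoin K S)) :=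
  ⟨_, rfl, h.modelJoin_sharpens, fun _ hc => h.modelJoin_satisfies hc,
    fun κ' hκ' hK =>
      (⟨hκ', hK⟩ : IsModelOf K (.mk S.U κ') S id).embeds_modelJoin⟩

end ModelJoin

/-! ### Materialisation -/

/-- An embedding of `T` lifts to a materialisation of `S`: matched individuals are represented by
the nodes of the left hand side, and the others as before. The set `Y` of kept individuals consists
of the matched ones that also represent an unmatched individual of `T`. -/
theorem IsEmbedding.mat {P : Rule.{u, v} (C₁ ⊕ C₂)} {T S : LStruct.{u, v} C₁ C₂ I}
    {f : T.U → S.U} (hf : IsEmbedding T S f) {m : P.NL → T.U} (hm : Function.Injective m)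
    (hsm : ∀ n, T.interp.sm (m n) = zero)
    (hun : ∀ (n : P.NL) (p : C₁), (n.1, Sum.inl p, n.1) ∈ P.EL → T.interp.un p (m n) = one)
    (hbin : ∀ (n n' : P.NL) (p : C₂), (n.1, Sum.inr p, n'.1) ∈ P.EL →
      T.interp.bin p (m n) (m n') = one) :
    ∃ Y ⊆ Set.range (f ∘ m) ∩ {x | S.interp.sm x = half},
      ∃ g : T.U → (P.mat S (f ∘ m) Y).U,
        IsEmbedding T (P.mat S (f ∘ m) Y) g ∧ ∀ n, (g (m n)).1 = .inr n := by
  classical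
  let Y : Set S.U := {y | y ∈ Set.range (f ∘ m) ∧ ∃ x, x ∉ Set.range m ∧ f x = y}
  have hY : ∀ {y}, y ∈ Y ↔ y ∈ Set.range (f ∘ m) ∧ ∃ x, x ∉ Set.range m ∧ f x = y := Iff.rfl
  let g : T.U → P.MatNodes (f ∘ m) Y := fun x =>
    if h : ∃ n, m n = x then ⟨.inr h.choose, by simp⟩
    else ⟨.inl (f x), by
      rintro z hz ⟨hz1, hz2⟩
      obtain rfl := Sum.inl_injective hz
      exact hz2 (hY.2 ⟨hz1, x, h, rfl⟩)⟩
  have gm : ∀ n, (g (m n)).1 = .inr n := by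
    intro n
    have h : ∃ n', m n' = m n := ⟨n, rfl⟩
    simp only [g, dif_pos h]
    rw [hm h.choose_spec]
  have gn : ∀ x, (¬ ∃ n, m n = x) → (g x).1 = .inl (f x) := by
    intro x h
    simp only [g, dif_neg h]
  have gf : ∀ x, Sum.elim id (f ∘ m) (g x).1 = f x := by
    intro x
    by_cases h : ∃ n, m n = x
    · obtain ⟨n, rfl⟩ := h
      rw [gm]; rfl
    · rw [gn x h]; rfl
  have ginr : ∀ {x n}, (g x).1 = .inr n → x = m n := by
    intro x n hx
    by_cases h : ∃ n, m n = x
    · obtain ⟨n', rfl⟩ := h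
      rw [gm] at hx
      rw [Sum.inr_injective hx]
    · rw [gn x h] at hx
      simp at hx
  refine ⟨Y, ?_, g, ?_, gm⟩
  · rintro y hy
    obtain ⟨⟨n, rfl⟩, x, hx, hxn⟩ := hY.1 hy
    refine ⟨⟨n, rfl⟩, ?_⟩
    rw [Set.mem_ofPred_eq, ← hxn]
    exact hf.sm_eq_half hxn fun e => hx ⟨n, e.symm⟩
  · refine ⟨?_, ?_, ?_, ?_, ?_, info_card ?_⟩
    · rintro ⟨y | n, hy⟩
      · have : ∃ x, x ∉ Set.range m ∧ f x = y := by
          by_cases h1 : y ∈ Set.range (f ∘ m)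
          · by_cases h2 : y ∈ Y
            · exact (hY.1 h2).2
            · exact absurd ⟨h1, h2⟩ (hy y rfl)
          · obtain ⟨x, rfl⟩ := hf.surj y
            exact ⟨x, fun ⟨n, hn⟩ => h1 ⟨n, congrArg f hn⟩, rfl⟩
        obtain ⟨x, hx, rfl⟩ := this
        exact ⟨x, Subtype.ext (gn x hx)⟩
      · exact ⟨m n, Subtype.ext (gm n)⟩
    · intro p x
      change Info _ (ite _ _ _)
      split_ifs with h
      · obtain ⟨n, hn, he⟩ := h
        rw [ginr hn, hun n p he]
        exact Info.refl _
      · rw [gf]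
        exact hf.un p x
    · intro p x y
      change Info _ (ite _ _ _)
      split_ifs with h
      · obtain ⟨n, n', hn, hn', he⟩ := h
        rw [ginr hn, ginr hn', hbin n n' p he]
        exact Info.refl _
      · rw [gf, gf]
        exact hf.bin p x y
    · intro q x
      change Info _ (S.interp.ins q (Sum.elim id (f ∘ m) (g x).1))
      rw [gf]
      exact hf.ins q x
    · intro x
      change Info _ (Sum.elim S.interp.sm (fun _ => zero) (g x).1)
      by_cases h : ∃ n, m n = x
      · obtain ⟨n, rfl⟩ := h
        rw [gm, hsm]
        exact Info.refl _
      · rw [gn x h]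
        exact hf.sm x
    · intro x x' hxx' hne
      change Sum.elim S.interp.sm (fun _ => zero) (g x).1 = half
      by_cases h : ∃ n, m n = x
      · obtain ⟨n, rfl⟩ := h
        exact absurd (ginr (hxx' ▸ gm n)).symm hne
      · rw [gn x h]
        refine hf.sm_eq_half ?_ hne
        rw [← gf x, ← gf x', hxx']

/-- If `T` has a match of the left hand side, then `T` is embedded in a materialisation of each of
its abstractions, where the match becomes definite. -/
theorem IsEmbedding.exists_materialises [Finite C₁] [Finite C₂] {P : Rule.{u, v} (C₁ ⊕ C₂)}
    {T S : LStruct.{u, v} C₁ C₂ I} {f : T.U → S.U} (hf : IsEmbedding T S f) (hS : Finite S.U)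
    {m : P.NL → T.U} (hm : (P.formula I).eval T.interp m = one) :
    ∃ S₁ g, P.Materialises S S₁ ∧ IsEmbedding T S₁ g ∧ Finite S₁.U ∧
      (P.formula I).eval S₁.interp (g ∘ m) = one := by
  rcases hf.info_eval (P.formula I) m with h | h
  · rw [hm] at h
    exact ⟨S, f, Or.inl ⟨rfl, _, h.symm⟩, hf, hS, h.symm⟩
  · obtain ⟨hbin, hun, hinj, hsm⟩ := P.formula_eval_eq_one.1 hm
    obtain ⟨Y, hY, g, hg, hgm⟩ := hf.mat hinj hsm hun hbin
    refine ⟨_, g, Or.inr ⟨f ∘ m, Y, h, hY, rfl⟩, hg, ?_, ?_⟩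
    · change Finite (P.MatNodes (f ∘ m) Y)
      infer_instance
    · rw [P.formula_eval_eq_one]
      refine ⟨fun n n' p he => if_pos ⟨n, n', hgm n, hgm n', he⟩,
        fun n p he => if_pos ⟨n, hgm n, he⟩, fun n n' e => ?_, fun n => ?_⟩
      · have := congrArg Subtype.val e
        simp only [Function.comp_apply] at this
        rw [hgm, hgm] at this
        exact Sum.inr_injective this
      · change Sum.elim S.interp.sm (fun _ => zero) (g (m n)).1 = zero
        rw [hgm]; rfl

/-! ### Rule application -/

namespace Rule

variable {Λ : Type v} {P : Rule.{u, v} Λ} {A B : Type u}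

theorem hat_comp (f : A → B) (m : P.NL → A) (a : P.Names) :
    P.hat (f ∘ m) a = Sum.map f id (P.hat m a) := by
  unfold hat
  split_ifs <;> rfl

theorem hat_injective {m : P.NL → A} (hm : Function.Injective m) :
    Function.Injective (P.hat m) := by
  intro a b h
  unfold hat at h
  split_ifs at h
  · exact Subtype.ext (congrArg (fun n : P.NL => n.1) (hm (Sum.inl_injective h)))
  · exact Subtype.ext (congrArg (fun n : P.NPlus => n.1) (Sum.inr_injective h))

/-- If matched individuals are not merged with others, then the image of a matching is reflected
by `f`, and so are the deleted and the created edges. -/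
theorem hat_comp_eq_iff {f : A → B} {m : P.NL → A} (hfib : ∀ n x, f x = f (m n) → x = m n)
    {a : P.Names} {y : A ⊕ P.NPlus} :
    P.hat (f ∘ m) a = Sum.map f id y ↔ P.hat m a = y := by
  rw [hat_comp]
  refine ⟨fun h => ?_, fun h => h ▸ rfl⟩
  unfold hat at h ⊢
  split_ifs at h ⊢ <;> rcases y with y | y <;> simp at h ⊢
  · exact (hfib _ _ h.symm).symm
  · exact h

theorem mem_delEdges_comp {f : A → B} {m : P.NL → A}
    (hfib : ∀ n x, f x = f (m n) → x = m n) {x y : A ⊕ P.NPlus} {l : Λ} :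
    (Sum.map f id x, l, Sum.map f id y) ∈ P.delEdges (f ∘ m) ↔ (x, l, y) ∈ P.delEdges m := by
  simp only [delEdges, Set.mem_ofPred_eq, hat_comp_eq_iff hfib]

theorem mem_newEdges_comp {f : A → B} {m : P.NL → A}
    (hfib : ∀ n x, f x = f (m n) → x = m n) {x y : A ⊕ P.NPlus} {l : Λ} :
    (Sum.map f id x, l, Sum.map f id y) ∈ P.newEdges (f ∘ m) ↔ (x, l, y) ∈ P.newEdges m := by
  simp only [newEdges, Set.mem_ofPred_eq, hat_comp_eq_iff hfib]

theorem not_mem_newEdges {m : P.NL → A} (hm : Function.Injective m)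
    {e : (A ⊕ P.NPlus) × Λ × (A ⊕ P.NPlus)} (he : e ∈ P.delEdges m) : e ∉ P.newEdges m := by
  rintro ⟨a, b, hab, ha, hb⟩
  obtain ⟨a', b', hab', ha', hb'⟩ := he
  obtain rfl := hat_injective hm (ha.trans ha'.symm)
  obtain rfl := hat_injective hm (hb.trans hb'.symm)
  exact hab.2 hab'.1

end Rule

/-- Application of a rule preserves embeddings, for a match whose individuals are not merged with
others. -/
theorem ShapeRule.exists_isEmbedding_apply {M : Meaning C₁ C₂ I} {P : ShapeRule.{u, v} C₁ C₂ I}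
    {G : Graph.{u, v} (C₁ ⊕ C₂)} {S : LStruct.{u, v} C₁ C₂ I} {f : G.N → S.U}
    (hf : IsEmbedding (encode M G) S f) {m : P.NL → G.N} (hm : Function.Injective m)
    (hupd : P.UpdateCorrect M G m) (hsm : ∀ n, S.interp.sm (f (m n)) = zero) :
    ∃ g, IsEmbedding (encode M (P.apply G m)) (P.applyShape S (f ∘ m)) g := by
  classical
  have hfib : ∀ n x, f x = f (m n) → x = m n := fun n x h => hf.eq_of_sm_eq_zero (hsm n) h
  let g : P.ResultNodes m → P.ResultNodes (f ∘ m) := fun x => ⟨Sum.map f id x.1, by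
    rintro n hn h
    obtain ⟨x | x, hx⟩ := x
    · exact hx n hn (congrArg _ (hfib n x (Sum.inl_injective h)))
    · simp at h⟩
  -- Unary predicates are loops, so that they can be treated together with binary ones. The value
  -- `b` is the one that `applyShape` gives to an edge that the rule neither deletes nor creates.
  have edge : ∀ (l : C₁ ⊕ C₂) (x y : P.ResultNodes m) (b : Kleene),
      (∀ z z', x.1 = .inl z → y.1 = .inl z' → Info (ofProp ((z, l, z') ∈ G.E)) b) →
      ((∀ z z', ¬ (x.1 = .inl z ∧ y.1 = .inl z')) → b = zero) →
      Info (ofProp ((x, l, y) ∈ (P.apply G m).E))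
        (if ((g x).1, l, (g y).1) ∈ P.delEdges (f ∘ m) then zero
          else if ((g x).1, l, (g y).1) ∈ P.newEdges (f ∘ m) then one else b) := by
    intro l x y b hold hnew
    have hE : (x, l, y) ∈ (P.apply G m).E ↔
        (x.1, l, y.1) ∈ (P.hostEdges G \ P.delEdges m) ∪ P.newEdges m := Iff.rfl
    simp only [g, Rule.mem_delEdges_comp hfib, Rule.mem_newEdges_comp hfib, hE, Set.mem_union,
      Set.mem_sdiff]
    by_cases h1 : (x.1, l, y.1) ∈ P.delEdges m
    · simp [h1, Rule.not_mem_newEdges hm h1, ofProp, Info]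
    · by_cases h2 : (x.1, l, y.1) ∈ P.newEdges m
      · simp [h1, h2, ofProp, Info]
      · simp only [h1, h2, not_false_eq_true, and_true, or_false, if_false]
        have hH : (x.1, l, y.1) ∈ P.hostEdges G ↔
          ∃ z z', (z, l, z') ∈ G.E ∧ x.1 = .inl z ∧ y.1 = .inl z' := Iff.rfl
        rw [hH]
        by_cases h3 : ∃ z z', x.1 = .inl z ∧ y.1 = .inl z'
        · obtain ⟨z, z', hz, hz'⟩ := h3
          simpa [hz, hz'] using hold z z' hz hz'
        · rw [hnew fun z z' h => h3 ⟨z, z', h⟩, ofProp,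
            if_neg fun ⟨z, z', _, h⟩ => h3 ⟨z, z', h⟩]
          exact Info.refl _
  refine ⟨g, ?_, ?_, ?_, ?_, ?_, info_card ?_⟩
  · rintro ⟨y | n, hy⟩
    · obtain ⟨x, rfl⟩ := hf.surj y
      refine ⟨⟨.inl x, fun n hn h => hy n hn ?_⟩, rfl⟩
      rw [Sum.inl_injective h]; rfl
    · exact ⟨⟨.inr n, by simp⟩, rfl⟩
  · intro p x
    refine edge (.inl p) x x _ ?_ ?_
    · rintro z z' hz hz'
      obtain rfl := Sum.inl_injective (hz.symm.trans hz')
      simp only [g, hz, Sum.map_inl]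
      exact hf.un p z
    · rcases x with ⟨z | n, hx⟩ <;> intro h
      · exact absurd ⟨rfl, rfl⟩ (h z z)
      · rfl
  · intro p x y
    refine edge (.inr p) x y _ ?_ ?_
    · rintro z z' hz hz'
      simp only [g, hz, hz', Sum.map_inl]
      exact hf.bin p z z'
    · rcases x with ⟨z | n, hx⟩ <;> rcases y with ⟨z' | n', hy⟩ <;> intro h
      · exact absurd ⟨rfl, rfl⟩ (h z z')
      all_goals rfl
  · intro q x
    change Info _ (dite _ _ _)
    split_ifs with h
    · rw [(hupd q x).1 h.choose ((Rule.hat_comp_eq_iff hfib).1 h.choose_spec)]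
      exact hf.info_eval _ m
    · -- A node outside the image of the right hand side lies outside the match altogether,
      -- since it would have been deleted otherwise.
      have h' : ∀ n : P.NR, P.hat m ⟨n.1, Or.inr n.2⟩ ≠ x.1 := fun n hn =>
        h ⟨n, (Rule.hat_comp_eq_iff hfib).2 hn⟩
      obtain ⟨z | n, hx⟩ := x
      · have hz : z ∉ Set.range m := by
          rintro ⟨n, rfl⟩
          by_cases hn : n.1 ∈ P.NR
          · exact h' ⟨n.1, hn⟩ (by simp [Rule.hat])
          · exact hx n hn rfl
        rw [(hupd q _).2 z hz rfl]
        exact hf.ins q z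
      · refine absurd ?_ (h' ⟨n.1, n.2.1⟩)
        simp [Rule.hat, n.2.2]
  · rintro ⟨z | n, hx⟩
    · exact hf.sm z
    · exact Info.refl _
  · rintro ⟨z | n, hx⟩ ⟨z' | n', hx'⟩ h hne
    all_goals
      have h1 := congrArg Subtype.val h
      simp only [g, Sum.map_inl, Sum.map_inr, id, reduceCtorEq] at h1
    · refine hf.sm_eq_half (Sum.inl_injective h1) fun e => hne ?_
      subst e; rfl
    · obtain rfl := Sum.inr_injective h1
      exact absurd rfl hne

/-! ### Simulation of a transformation step -/

theorem formula_eval_encode [Finite C₁] [Finite C₂] {M : Meaning C₁ C₂ I}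
    {P : Rule.{u, v} (C₁ ⊕ C₂)} {G : Graph.{u, v} (C₁ ⊕ C₂)} {m : P.NL → G.N}
    (hm : P.IsMatching G m) : (P.formula I).eval (encode M G).interp m = one :=
  P.formula_eval_eq_one.2 ⟨fun n n' _ he => if_pos (hm.2 n _ n' he),
    fun n _ he => if_pos (hm.2 n _ n he), hm.1, fun _ => rfl⟩

/-- Each graph transformation step is simulated by a step from any finite abstraction of the
graph. -/
theorem ShapeRule.exists_step [Finite C₁] [Finite C₂] {M : Meaning C₁ C₂ I}
    {K : Set (Constraint C₁ C₂ I)} {P : ShapeRule.{u, v} C₁ C₂ I} {G : Graph.{u, v} (C₁ ⊕ C₂)}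
    {m : P.NL → G.N} (hm : P.IsMatching G m) (hupd : P.UpdateCorrect M G m)
    (hG : ∀ c ∈ K, (encode M G).interp.Satisfies c)
    (hH : ∀ c ∈ K, (encode M (P.apply G m)).interp.Satisfies c)
    {S : LStruct.{u, v} C₁ C₂ I} (hS : Finite S.U) (h : (encode M G).Embeds S) :
    ∃ T, P.Step K S T ∧ Finite T.U ∧ (encode M (P.apply G m)).Embeds T := by
  obtain ⟨f, hf⟩ := h
  obtain ⟨S₁, f₁, hmat, hf₁, hfin, hm₁⟩ := hf.exists_materialises hS (formula_eval_encode hm)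
  have hmod : IsModelOf K _ S₁ f₁ := ⟨hf₁, hG⟩
  have hm₂ : (P.formula I).eval (modelJoin K S₁) (f₁ ∘ m) = one :=
    hmod.modelJoin_sharpens.eval_eq_one hm₁
  obtain ⟨hbin, hun, hinj, hsm⟩ := P.formula_eval_eq_one.1 hm₂
  obtain ⟨g, hg⟩ :=
    ShapeRule.exists_isEmbedding_apply hmod.embeds_modelJoin hm.1 hupd hsm
  have hmod' : IsModelOf K _ _ g := ⟨hg, hH⟩
  refine ⟨_, ⟨S₁, _, hmat, hmod.coerces, f₁ ∘ m, ⟨hinj, hun, hbin⟩, hmod'.coerces⟩, ?_,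
    g, hmod'.embeds_modelJoin⟩
  have : Finite P.NPlus :=
    Finite.of_injective (fun n : P.NPlus => (⟨n.1, n.2.1⟩ : P.NR))
      fun a b h => Subtype.ext (congrArg (fun n : P.NR => n.1) h)
  change Finite (P.ResultNodes (f₁ ∘ m))
  infer_instance

/-! ### Maximal structures -/

instance : Finite Kleene :=
  Finite.of_injective (fun a : Kleene => (⟨a.ctorIdx, by cases a <;> decide⟩ : Fin 3)) <| by
    rintro (_ | _ | _) (_ | _ | _) <;> simp [Kleene.ctorIdx]

/-- The data of an abstraction of a structure with universe `A`, pulled back along the embedding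
`f`: which individuals are identified, and the values of the predicates. -/
def pullback {A : Type u} (T : LStruct.{u, v} C₁ C₂ I) (f : A → T.U) :
    (A → A → Prop) × (C₁ → A → Kleene) × (C₂ → A → A → Kleene) × (I → A → Kleene) ×
      (A → Kleene) :=
  (fun x y => f x = f y, fun p x => T.interp.un p (f x), fun p x y => T.interp.bin p (f x) (f y),
    fun q x => T.interp.ins q (f x), fun x => T.interp.sm (f x))

/-- Abstractions with the same pulled back data are embedded in each other. -/
theorem embeds_of_pullback_eq {A : Type u} {T R : LStruct.{u, v} C₁ C₂ I} {f : A → T.U}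
    {g : A → R.U} (hf : Function.Surjective f) (hg : Function.Surjective g)
    (h : pullback T f = pullback R g) : T.Embeds R := by
  simp only [pullback, Prod.mk.injEq, funext_iff, eq_iff_iff] at h
  obtain ⟨h1, h2, h3, h4, h5⟩ := h
  obtain ⟨s, hs⟩ := hf.hasRightInverse
  refine ⟨g ∘ s, ⟨fun y => ?_, fun p x => Or.inl ?_, fun p x y => Or.inl ?_,
    fun q x => Or.inl ?_, fun x => Or.inl ?_, info_card fun x x' e hne => ?_⟩⟩
  · obtain ⟨a, rfl⟩ := hg y
    exact ⟨f a, (h1 _ _).1 (hs (f a))⟩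
  · simp only [Function.comp_apply, ← h2, hs x]
  · simp only [Function.comp_apply, ← h3, hs x, hs y]
  · simp only [Function.comp_apply, ← h4, hs x]
  · simp only [Function.comp_apply, ← h5, hs x]
  · refine absurd ?_ hne
    rw [← hs x, ← hs x']
    exact (h1 _ _).2 e

/-- Above each finite structure of a set there is a maximal one, because a finite structure has
only finitely many abstractions up to mutual embedding. -/
theorem exists_mem_maxStructs [Finite C₁] [Finite C₂] [Finite I]
    {X : Set (LStruct.{u, v} C₁ C₂ I)} {S : LStruct.{u, v} C₁ C₂ I} (hS : S ∈ X)
    (hfin : Finite S.U) : ∃ T ∈ maxStructs X, S.Embeds T := by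
  let pre : Preorder (LStruct.{u, v} C₁ C₂ I) :=
    { le := LStruct.Embeds
      le_refl := Embeds.refl
      le_trans := fun _ _ _ => Embeds.trans }
  let Y : Type (max (u + 1) v) :=
    {t : (T : LStruct.{u, v} C₁ C₂ I) × (S.U → T.U) // t.1 ∈ X ∧ IsEmbedding S t.1 t.2}
  let code := fun t : Y => pullback t.1.1 t.1.2
  -- One abstraction in `X` for each value of the pulled back data; there are finitely many values.
  let rep : Set.range code → LStruct.{u, v} C₁ C₂ I := fun c => c.2.choose.1.1
  have : Nonempty (Set.range code) := ⟨_, ⟨⟨S, id⟩, hS, .refl S⟩, rfl⟩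
  obtain ⟨c, -, hc⟩ := Set.finite_univ.exists_maximalFor rep Set.univ Set.univ_nonempty
  have hcX := c.2.choose.2
  refine ⟨rep c, ⟨hcX.1, ?_⟩, _, hcX.2⟩
  rintro ⟨T, hT, hcT, hTc⟩
  obtain ⟨k, hk⟩ := hcT
  let t : Y := ⟨⟨T, k ∘ c.2.choose.1.2⟩, hT, hcX.2.trans hk⟩
  let d : Set.range code := ⟨code t, t, rfl⟩
  have hd : code d.2.choose = code t := d.2.choose_spec
  have hTd : T.Embeds (rep d) :=
    embeds_of_pullback_eq t.2.2.surj d.2.choose.2.2.surj hd.symm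
  exact hTc (Embeds.trans hTd (hc (Set.mem_univ d) (Embeds.trans ⟨k, hk⟩ hTd)))

end ShapeAnalysis

open ShapeAnalysis in
theorem theorem2 {C₁ C₂ I : Type v} [Finite C₁] [Finite C₂] [Finite I] {J : Type w}
    (M : Meaning C₁ C₂ I) (K : Set (Constraint C₁ C₂ I))
    (GT : GTS.{u, v, w} (C₁ ⊕ C₂) J) (ST : STS.{u, v, w} C₁ C₂ I J)
    (hfin : Finite ST.start.U)
    (hassoc : ST.IsAssociated GT)
    (hstart : (encode M GT.start).Embeds ST.start)
    (hconstraints : ∀ G ∈ GT.reach, ∀ c ∈ K, (encode M G).interp.Satisfies c)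
    (hupdate : ∀ G ∈ GT.reach, ∀ (i : J) (m : (ST.rule i).NL → G.N),
      (ST.rule i).IsMatching G m → (ST.rule i).UpdateCorrect M G m) :
    encode M '' GT.reach ⊆
      {T | T.TwoValued ∧ ∃ S ∈ ST.reach K, T.Embeds S} := by
  obtain ⟨G₀, rule⟩ := GT
  obtain rfl : rule = fun i => (ST.rule i).toRule := hassoc
  rintro _ ⟨G, hG, rfl⟩
  refine ⟨encode_twoValued M G, ?_⟩
  suffices h : ∃ S, Relation.ReflTransGen (fun S T => ∃ i, (ST.rule i).Step K S T) ST.start S ∧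
      Finite S.U ∧ (encode M G).Embeds S by
    obtain ⟨S, hS, hSfin, hGS⟩ := h
    obtain ⟨T, hT, hST⟩ := exists_mem_maxStructs hS hSfin
    exact ⟨T, hT, Embeds.trans hGS hST⟩
  change Relation.ReflTransGen _ _ _ at hG
  induction hG with
  | refl => exact ⟨_, .refl, hfin, hstart⟩
  | tail hG hstep ih =>
    obtain ⟨S, hS, hSfin, hGS⟩ := ih
    have hH := hG.tail hstep
    obtain ⟨i, m, hm, rfl⟩ := hstep
    obtain ⟨T, hT, hTfin, hHT⟩ := ShapeRule.exists_step hm (hupdate _ hG i m hm)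
      (hconstraints _ hG) (hconstraints _ hH) hSfin hGS
    exact ⟨T, hS.tail ⟨i, hT⟩, hTfin, hHT⟩
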